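/- Let $d\in\mathbf{N}$, let $\mu$ be a Borel probability measure on $\mathbf{R}^d$ and let $p\in[1,2]$. For $n\in\mathbf{N}$ let $\mu^n$ be the product measure on $(\mathbf{R}^d)^n$ and, for $q\ge 1$, let $B_q=\{x\in(\mathbf{R}^d)^n:\sum_{i=1}^n\sum_{j=1}^d|x^i_j|^q\le 1\}$ be the closed $\ell^q$ unit ball of $(\mathbf{R}^d)^n$. For real $a>0$ and $b\ge 0$, say that $\mu$ satisfies the two level dimension free concentration inequality $\mathbf{C}_p(a,b)$ if for every $n$ and every measurable $A\subset(\mathbf{R}^d)^n$ with $\mu^n(A)\ge 1/2$, \[\forall r\ge 0,\qquad \mu^n\left(A+\sqrt{r}\,B_2+r^{1/p}B_p\right)\ge 1-b\,e^{-ar}.\] For probability measures $\nu_1,\nu_2$ on $\mathbf{R}^d$ let \[\mathcal{T}_{2,p}(\nu_1,\nu_2)=\inf_{\pi}\int\sum_{j=1}^d\alpha_p(x_j-y_j)\,d\pi(x,y)\in[0,+\infty],\qquad \alpha_p(u)=\min(|u|^2,|u|^p),\] where $\pi$ runs over the probability measures on $\mathbf{R}^d\times\mathbf{R}^d$ with marginals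 $\nu_1$ and $\nu_2$. Let $\operatorname{H}(\nu\,|\,\mu)=\int\log\frac{d\nu}{d\mu}\,d\nu$ if $\nu$ is absolutely continuous with respect to $\mu$, and $+\infty$ otherwise. For real $C>0$, say that $\mu$ satisfies the transportation-cost inequality $\mathbf{T}_{2,p}(C)$ if $\mathcal{T}_{2,p}(\nu,\mu)\le C\operatorname{H}(\nu\,|\,\mu)$ for every probability measure $\nu$ on $\mathbf{R}^d$. Then the following are equivalent: (1) there are $a>0$ and $b\ge 0$ such that $\mu$ satisfies $\mathbf{C}_p(a,b)$; (2) there is $C>0$ such that $\mu$ satisfies $\mathbf{T}_{2,p}(C)$. More precisely, if $\mu$ satisfies $\mathbf{C}_p(a,b)$ for some $a>0$ and $b\ge 0$, then it satisfies $\mathbf{T}_{2,p}(288/a)$; conversely, if $\mu$ satisfies $\mathbf{T}_{2,p}(C)$ for some $C>0$, then it satisfies $\mathbf{C}_p\left(\frac{1}{2C},2\right)$. -/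

import Mathlib

open MeasureTheory
open scoped Pointwise ENNReal

noncomputable section

/-- The closed unit ball `{x : ‖x‖_q ≤ 1}` of the `ℓ^q` norm on `(ℝ^d)^n`, where
`‖x‖_q = (∑ i, ∑ j, |x i j| ^ q) ^ (1 / q)` is the `ℓ^q` norm of all `n * d` coordinates
(for `q > 0` the condition `‖x‖_q ≤ 1` is `∑ i, ∑ j, |x i j| ^ q ≤ 1`). -/
def lqUnitBall (n d : ℕ) (q : ℝ) : Set (Fin n → Fin d → ℝ) :=
  {x | ∑ i, ∑ j, |x i j| ^ q ≤ 1}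

/-- The two level concentration inequality of order `p` with constants `a`, `b`, in every
dimension `n`: for every Borel set `A` of `(ℝ^d)^n` with `μ^n(A) ≥ 1/2` and every `r ≥ 0`,
`μ^n(A + √r B_2 + r^{1/p} B_p) ≥ 1 - b e^{-a r}`. -/
def TwoLevelConcentration {d : ℕ} (μ : Measure (Fin d → ℝ)) (p a b : ℝ) : Prop :=
  ∀ (n : ℕ) (A : Set (Fin n → Fin d → ℝ)), MeasurableSet A →
    1 / 2 ≤ (Measure.pi fun _ : Fin n => μ).real A →
    ∀ r : ℝ, 0 ≤ r →
      1 - b * Real.exp (-a * r) ≤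
        (Measure.pi fun _ : Fin n => μ).real
          (A + √r • lqUnitBall n d 2 + r ^ (1 / p) • lqUnitBall n d p)

/-- The function `α_p(u) = min(|u|^2, |u|^p)` on `ℝ`. -/
def twoLevelCost (p u : ℝ) : ℝ := min (|u| ^ 2) (|u| ^ p)

/-- The optimal transportation cost
`T_{2,p}(ν₁, ν₂) = inf_π ∫ ∑ j, α_p(x j - y j) dπ(x, y)`, the infimum being over all couplings
`π` of `ν₁` and `ν₂`; its value lies in `[0, ∞]`. -/
def transportCost {d : ℕ} (p : ℝ) (ν₁ ν₂ : Measure (Fin d → ℝ)) : ℝ≥0∞ :=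
  ⨅ (π : Measure ((Fin d → ℝ) × (Fin d → ℝ))) (_ : π.fst = ν₁ ∧ π.snd = ν₂),
    ∫⁻ z, ENNReal.ofReal (∑ j, twoLevelCost p (z.1 j - z.2 j)) ∂π

/-- The transportation-cost inequality `T_{2,p}(ν, μ) ≤ C H(ν | μ)` for all probability
measures `ν` on `ℝ^d`, where `H` is the relative entropy, with values in `[0, ∞]`. -/
def TransportInequality {d : ℕ} (μ : Measure (Fin d → ℝ)) (p C : ℝ) : Prop :=
  ∀ ν : Measure (Fin d → ℝ), IsProbabilityMeasure ν →
    transportCost p ν μ ≤ ENNReal.ofReal C * InformationTheory.klDiv ν μ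

end

/-! Write `c` for the sum of the costs `α_p` of the coordinates. Since `√α_p` is subadditive, `c`
satisfies a triangle inequality up to a factor 2, and `A + √r B_2 + r^{1/p} B_p` lies between the
`c`-enlargements of `A` of sizes `r` and `4r`.

Transport to concentration: duality, tested on exponentially tilted measures, turns the transport
inequality into property `(τ)` for `c / (2C)` (`TransportInequality.propertyTau`). This property
tensorizes (`PropertyTau.pi`), and two-valued functions then give concentration.

Concentration to transport: let `H = H(ν|μ)` be finite. By change of measure, samples of size `N`
with empirical measure near `ν` have `μ^N`-probability at least about `e^{-NH}`. This beats `b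
e^{-ar}` once `r` slightly exceeds `NH/a`, so some such sample lies in the enlargement of the set of
samples with empirical measure near `μ` (`exists_empirical_near`). Pairing the two samples couples
their empirical measures at cost at most about `4H/a`; tightness and lower semicontinuity pass to
the limit. The resulting constant `4/a` is better than `288/a`. -/

section Cost

/-! ### The two level cost and its weak triangle inequality. -/

lemma twoLevelCost_nonneg (p u : ℝ) : 0 ≤ twoLevelCost p u :=
  le_min (by positivity) (Real.rpow_nonneg (abs_nonneg u) p)

lemma twoLevelCost_neg (p u : ℝ) : twoLevelCost p (-u) = twoLevelCost p u := by
  simp [twoLevelCost]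

lemma twoLevelCost_sub_comm (p u v : ℝ) : twoLevelCost p (u - v) = twoLevelCost p (v - u) := by
  rw [← twoLevelCost_neg, neg_sub]

lemma continuous_twoLevelCost {p : ℝ} (hp : 0 ≤ p) : Continuous (twoLevelCost p) :=
  (continuous_abs.pow 2).min (continuous_abs.rpow_const fun _ => Or.inr hp)

/-- Cross-multiplied form of the fact that `h t / t` is nonincreasing for `h t = min t (t ^ q)`. -/
lemma min_rpow_mul_le {q s t : ℝ} (hq : q ≤ 1) (hs : 0 < s) (hst : s ≤ t) :
    min t (t ^ q) * s ≤ min s (s ^ q) * t := by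
  have ht : 0 < t := hs.trans_le hst
  rcases min_choice s (s ^ q) with h | h
  · rw [h, mul_comm s]
    gcongr
    exact min_le_left _ _
  · rw [h]
    calc min t (t ^ q) * s ≤ t ^ q * s := by gcongr; exact min_le_right _ _
      _ = t ^ (q - 1) * (t * s) := by
        rw [Real.rpow_sub_one ht.ne']; field_simp
      _ ≤ s ^ (q - 1) * (t * s) := by
        gcongr ?_ * _
        exact Real.rpow_le_rpow_of_nonpos hs hst (by linarith)
      _ = s ^ q * t := by
        rw [Real.rpow_sub_one hs.ne']; field_simp

/-- A function `h` with `h t / t` nonincreasing is subadditive: split `h (s + t)` in proportion to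
`s` and `t`. -/
lemma min_rpow_add_le {q s t : ℝ} (hq : 0 < q) (hq1 : q ≤ 1) (hs : 0 ≤ s) (ht : 0 ≤ t) :
    min (s + t) ((s + t) ^ q) ≤ min s (s ^ q) + min t (t ^ q) := by
  rcases hs.eq_or_lt with rfl | hs
  · simp [Real.zero_rpow hq.ne']
  rcases ht.eq_or_lt with rfl | ht
  · simp [Real.zero_rpow hq.ne']
  have h1 := min_rpow_mul_le hq1 hs (le_add_of_nonneg_right ht.le : s ≤ s + t)
  have h2 := min_rpow_mul_le hq1 ht (le_add_of_nonneg_left hs.le : t ≤ s + t)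
  have h3 : min (s + t) ((s + t) ^ q) * (s + t) ≤ (min s (s ^ q) + min t (t ^ q)) * (s + t) := by
    linarith
  exact le_of_mul_le_mul_right h3 (by positivity)

lemma twoLevelCost_eq_sq (p u : ℝ) : twoLevelCost p u = (min |u| (|u| ^ (p / 2))) ^ 2 := by
  have h2 : (|u| ^ (p / 2)) ^ 2 = |u| ^ p := by
    rw [← Real.rpow_natCast, ← Real.rpow_mul (abs_nonneg u)]
    congr 1
    push_cast
    ring
  rw [twoLevelCost, ← h2]
  have ha := abs_nonneg u
  have hb : 0 ≤ |u| ^ (p / 2) := by positivity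
  rcases le_total |u| (|u| ^ (p / 2)) with h | h
  · rw [min_eq_left h, min_eq_left (by gcongr)]
  · rw [min_eq_right h, min_eq_right (by gcongr)]

/-- Subadditivity of the square root of the cost, with `(s + t)² ≤ 2s² + 2t²`. The factor 2 is the
source of both the `4` in `4 / a` and the `2` in `1 / (2C)`. -/
lemma twoLevelCost_add_le {p : ℝ} (hp : p ∈ Set.Icc (1 : ℝ) 2) (u v : ℝ) :
    twoLevelCost p (u + v) ≤ 2 * twoLevelCost p u + 2 * twoLevelCost p v := by
  obtain ⟨h1, h2⟩ := hp
  simp only [twoLevelCost_eq_sq]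
  have hq : 0 < p / 2 := by linarith
  have h0 : ∀ w : ℝ, 0 ≤ min |w| (|w| ^ (p / 2)) := fun w => le_min (by positivity) (by positivity)
  have hmono : min |u + v| (|u + v| ^ (p / 2)) ≤ min (|u| + |v|) ((|u| + |v|) ^ (p / 2)) :=
    min_le_min (abs_add_le u v) (Real.rpow_le_rpow (abs_nonneg _) (abs_add_le u v) hq.le)
  have hadd := hmono.trans
    (min_rpow_add_le hq (by linarith) (abs_nonneg u) (abs_nonneg v))
  have := pow_le_pow_left₀ (h0 (u + v)) hadd 2
  nlinarith [sq_nonneg (min |u| (|u| ^ (p / 2)) - min |v| (|v| ^ (p / 2)))]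

lemma sq_le_twoLevelCost {p u : ℝ} (hp : p ≤ 2) (hu : |u| ≤ 1) :
    |u| ^ 2 ≤ twoLevelCost p u := by
  refine le_min le_rfl ?_
  rcases eq_or_ne u 0 with rfl | h0
  · simpa using Real.rpow_nonneg le_rfl p
  rw [← Real.rpow_natCast]
  exact Real.rpow_le_rpow_of_exponent_ge (abs_pos.2 h0) hu (by exact_mod_cast hp)

lemma rpow_le_twoLevelCost {p u : ℝ} (hp : p ≤ 2) (hu : 1 ≤ |u|) :
    |u| ^ p ≤ twoLevelCost p u := by
  refine le_min ?_ le_rfl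
  rw [← Real.rpow_natCast]
  exact Real.rpow_le_rpow_of_exponent_le hu (by exact_mod_cast hp)

end Cost

/-! ### Comparison of the enlargements with cost neighbourhoods. -/

section Balls

variable {n d : ℕ}

lemma mem_smul_lqUnitBall {q r : ℝ} (hq : 0 < q) (hr : 0 ≤ r) {z : Fin n → Fin d → ℝ} :
    z ∈ r ^ (1 / q) • lqUnitBall n d q ↔ ∑ i, ∑ j, |z i j| ^ q ≤ r := by
  have key : ∀ {s : ℝ}, 0 ≤ s → ∀ w : Fin n → Fin d → ℝ,
      ∑ i, ∑ j, |(s ^ (1 / q) • w) i j| ^ q = s * ∑ i, ∑ j, |w i j| ^ q := by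
    intro s hs w
    simp only [Finset.mul_sum, Pi.smul_apply, smul_eq_mul]
    refine Finset.sum_congr rfl fun i _ => Finset.sum_congr rfl fun j _ => ?_
    rw [abs_mul, Real.mul_rpow (abs_nonneg _) (abs_nonneg _), abs_of_nonneg (by positivity),
      ← Real.rpow_mul hs, one_div_mul_cancel hq.ne', Real.rpow_one]
  rcases hr.eq_or_lt with rfl | hr
  · have h0 : (0 : ℝ) ^ (1 / q) = 0 := Real.zero_rpow (by positivity)
    constructor
    · rintro ⟨w, -, rfl⟩
      exact ((key le_rfl w).trans (zero_mul _)).le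
    · intro h
      have hz : z = 0 := by
        have h' : ∑ i, ∑ j, |z i j| ^ q = 0 :=
          le_antisymm h (Finset.sum_nonneg fun i _ => Finset.sum_nonneg fun j _ => by positivity)
        ext i j
        have h1 := (Finset.sum_eq_zero_iff_of_nonneg
          (fun i _ => Finset.sum_nonneg fun j _ => by positivity)).1 h' i (Finset.mem_univ _)
        have h2 := (Finset.sum_eq_zero_iff_of_nonneg
          (fun j _ => by positivity)).1 h1 j (Finset.mem_univ _)
        simpa using (Real.rpow_eq_zero (abs_nonneg _) hq.ne').1 h2
      exact ⟨0, by simp [lqUnitBall, Real.zero_rpow hq.ne'], by simp [hz]⟩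
  · have hs : r ^ (1 / q) ≠ 0 := (Real.rpow_pos_of_pos hr _).ne'
    rw [Set.mem_smul_set_iff_inv_smul_mem₀ hs]
    have h := key hr.le ((r ^ (1 / q))⁻¹ • z)
    rw [smul_inv_smul₀ hs] at h
    rw [h, lqUnitBall, Set.mem_ofPred_eq]
    constructor
    · intro h1
      nlinarith
    · intro h1
      nlinarith

lemma mem_sqrt_smul_lqUnitBall {r : ℝ} (hr : 0 ≤ r) {z : Fin n → Fin d → ℝ} :
    z ∈ √r • lqUnitBall n d 2 ↔ ∑ i, ∑ j, |z i j| ^ 2 ≤ r := by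
  rw [Real.sqrt_eq_rpow, mem_smul_lqUnitBall two_pos hr]
  norm_cast

/-- Coordinates of `x - y` of modulus at most 1, where the cost is quadratic, go to the `ℓ²` ball;
the others go to the `ℓ^p` ball. -/
lemma mem_enlargement_of_cost_le {p : ℝ} (hp : p ∈ Set.Icc (1 : ℝ) 2) {r : ℝ} (hr : 0 ≤ r)
    {A : Set (Fin n → Fin d → ℝ)} {x y : Fin n → Fin d → ℝ} (hy : y ∈ A)
    (h : ∑ i, ∑ j, twoLevelCost p (x i j - y i j) ≤ r) :
    x ∈ A + √r • lqUnitBall n d 2 + r ^ (1 / p) • lqUnitBall n d p := by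
  classical
  obtain ⟨hp1, hp2⟩ := hp
  have hp0 : 0 < p := by linarith
  let z := x - y
  let u : Fin n → Fin d → ℝ := fun i j => if |z i j| ≤ 1 then z i j else 0
  let v : Fin n → Fin d → ℝ := fun i j => if |z i j| ≤ 1 then 0 else z i j
  have hu : u ∈ √r • lqUnitBall n d 2 := by
    refine (mem_sqrt_smul_lqUnitBall hr).2 (le_trans ?_ h)
    refine Finset.sum_le_sum fun i _ => Finset.sum_le_sum fun j _ => ?_
    by_cases hz : |z i j| ≤ 1
    · simp only [u, if_pos hz]
      exact sq_le_twoLevelCost hp2 hz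
    · simp only [u, if_neg hz]
      simpa using twoLevelCost_nonneg p _
  have hv : v ∈ r ^ (1 / p) • lqUnitBall n d p := by
    refine (mem_smul_lqUnitBall hp0 hr).2 (le_trans ?_ h)
    refine Finset.sum_le_sum fun i _ => Finset.sum_le_sum fun j _ => ?_
    by_cases hz : |z i j| ≤ 1
    · simp only [v, if_pos hz]
      simpa [Real.zero_rpow hp0.ne'] using twoLevelCost_nonneg p _
    · simp only [v, if_neg hz]
      exact rpow_le_twoLevelCost hp2 (not_le.1 hz).le
  have hx : x = y + u + v := by
    ext i j
    have h1 : u i j + v i j = x i j - y i j := by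
      simp only [u, v]
      split_ifs <;> simp [z]
    simp only [Pi.add_apply]
    linarith
  rw [hx]
  exact Set.add_mem_add (Set.add_mem_add hy hu) hv

lemma exists_cost_le_of_mem_enlargement {p : ℝ} (hp : p ∈ Set.Icc (1 : ℝ) 2) {r : ℝ} (hr : 0 ≤ r)
    {A : Set (Fin n → Fin d → ℝ)} {x : Fin n → Fin d → ℝ}
    (hx : x ∈ A + √r • lqUnitBall n d 2 + r ^ (1 / p) • lqUnitBall n d p) :
    ∃ y ∈ A, ∑ i, ∑ j, twoLevelCost p (x i j - y i j) ≤ 4 * r := by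
  obtain ⟨w, ⟨y, hy, u, hu, rfl⟩, v, hv, rfl⟩ := hx
  refine ⟨y, hy, ?_⟩
  have hu' := (mem_sqrt_smul_lqUnitBall hr).1 hu
  have hv' := (mem_smul_lqUnitBall (by linarith [hp.1]) hr).1 hv
  have : ∑ i, ∑ j, twoLevelCost p (((y + u) + v) i j - y i j) ≤
      ∑ i, ∑ j, (2 * |u i j| ^ 2 + 2 * |v i j| ^ p) := by
    refine Finset.sum_le_sum fun i _ => Finset.sum_le_sum fun j _ => ?_
    have h : ((y + u) + v) i j - y i j = u i j + v i j := by
      simp only [Pi.add_apply]; ring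
    rw [h]
    refine (twoLevelCost_add_le hp _ _).trans ?_
    gcongr
    · exact min_le_left _ _
    · exact min_le_right _ _
  refine this.trans ?_
  simp only [Finset.sum_add_distrib, ← Finset.mul_sum]
  linarith

end Balls

/-! ### Property `(τ)`: tensorization and concentration. -/

section PropertyTau

/-- Maurey's property `(τ)` for the cost `c`, in symmetric functional form: the product of the
integrals of `F` and `G` is at most one as soon as `F x * G y ≤ exp (c x y)`. -/
def PropertyTau {X : Type*} [MeasurableSpace X] (μ : Measure X) (c : X → X → ℝ) : Prop :=
  ∀ F G : X → ℝ, Measurable F → Measurable G →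
    (∃ ε > 0, ∃ M, ∀ x, F x ∈ Set.Icc ε M) → (∃ ε > 0, ∃ M, ∀ x, G x ∈ Set.Icc ε M) →
    (∀ x y, F x * G y ≤ Real.exp (c x y)) → (∫ x, F x ∂μ) * (∫ x, G x ∂μ) ≤ 1

lemma integrable_of_mem_Icc {X : Type*} [MeasurableSpace X] {μ : Measure X} [IsFiniteMeasure μ]
    {f : X → ℝ} (hf : Measurable f) {a b : ℝ} (h : ∀ x, f x ∈ Set.Icc a b) : Integrable f μ := by
  refine Integrable.of_bound hf.aestronglyMeasurable (max |a| |b|) (Filter.Eventually.of_forall ?_)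
  intro x
  exact abs_le_max_abs_abs (h x).1 (h x).2

lemma integral_mem_Icc {X : Type*} [MeasurableSpace X] {μ : Measure X} [IsProbabilityMeasure μ]
    {f : X → ℝ} (hf : Measurable f) {a b : ℝ} (h : ∀ x, f x ∈ Set.Icc a b) :
    ∫ x, f x ∂μ ∈ Set.Icc a b := by
  have hi := integrable_of_mem_Icc (μ := μ) hf h
  constructor
  · simpa using integral_mono (integrable_const a) hi fun x => (h x).1
  · simpa using integral_mono hi (integrable_const b) fun x => (h x).2

lemma integral_pi_succ {X : Type*} [MeasurableSpace X] {μ : Measure X} [IsProbabilityMeasure μ]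
    {n : ℕ} {F : (Fin (n + 1) → X) → ℝ} (hF : Measurable F) {a b : ℝ}
    (h : ∀ x, F x ∈ Set.Icc a b) :
    ∫ x, F x ∂(Measure.pi fun _ => μ) =
      ∫ x₀, ∫ x', F (Fin.cons x₀ x') ∂(Measure.pi fun _ : Fin n => μ) ∂μ := by
  have hmp := (measurePreserving_piFinSuccAbove (fun _ : Fin (n + 1) => μ) 0).symm
  rw [← hmp.integral_comp (MeasurableEquiv.measurableEmbedding _), integral_prod]
  · simp [MeasurableEquiv.piFinSuccAbove, Fin.insertNthEquiv]
  · exact integrable_of_mem_Icc (hF.comp (MeasurableEquiv.measurable _)) fun x => h _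

lemma measurable_fin_cons {X : Type*} [MeasurableSpace X] {n : ℕ} :
    Measurable fun z : X × (Fin n → X) => (Fin.cons z.1 z.2 : Fin (n + 1) → X) := by
  refine measurable_pi_iff.2 fun i => ?_
  refine Fin.cases ?_ (fun j => ?_) i
  · simpa using measurable_fst
  · simpa [Function.comp_def] using (measurable_pi_apply j).comp measurable_snd

theorem PropertyTau.pi {X : Type*} [MeasurableSpace X] {μ : Measure X} [IsProbabilityMeasure μ]
    {c : X → X → ℝ} (h : PropertyTau μ c) (n : ℕ) :
    PropertyTau (Measure.pi fun _ : Fin n => μ) fun x y => ∑ i, c (x i) (y i) := by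
  induction n with
  | zero =>
    intro F G hF hG _ _ hFG
    have := hFG isEmptyElim isEmptyElim
    simpa [Measure.pi_of_empty (fun _ : Fin 0 => μ) isEmptyElim] using this
  | succ n ih =>
    rintro F G hF hG ⟨ε, hε, M, hFM⟩ ⟨δ, hδ, N, hGN⟩ hFG
    have hFc : ∀ x₀ : X, Measurable fun x' : Fin n → X => F (Fin.cons x₀ x') := fun x₀ =>
      hF.comp (measurable_fin_cons.comp (measurable_const.prodMk measurable_id))
    have hGc : ∀ x₀ : X, Measurable fun x' : Fin n → X => G (Fin.cons x₀ x') := fun x₀ =>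
      hG.comp (measurable_fin_cons.comp (measurable_const.prodMk measurable_id))
    rw [integral_pi_succ hF hFM, integral_pi_succ hG hGN]
    refine h _ _ ?_ ?_ ⟨ε, hε, M, fun x => integral_mem_Icc (hFc x) fun _ => hFM _⟩
      ⟨δ, hδ, N, fun x => integral_mem_Icc (hGc x) fun _ => hGN _⟩ ?_
    · exact ((hF.comp measurable_fin_cons).stronglyMeasurable.integral_prod_right'
        (ν := Measure.pi fun _ : Fin n => μ)).measurable
    · exact ((hG.comp measurable_fin_cons).stronglyMeasurable.integral_prod_right'
        (ν := Measure.pi fun _ : Fin n => μ)).measurable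
    intro x₀ y₀
    -- For fixed first coordinates, the factor `exp (-c x₀ y₀)` absorbs their cost, so the induction
    -- hypothesis bounds the product of the inner integrals by `exp (c x₀ y₀)`.
    have hpos := Real.exp_pos (-c x₀ y₀)
    have := ih (fun x' => Real.exp (-c x₀ y₀) * F (Fin.cons x₀ x')) (fun y' => G (Fin.cons y₀ y'))
      ((hFc x₀).const_mul _) (hGc y₀)
      ⟨Real.exp (-c x₀ y₀) * ε, by positivity, Real.exp (-c x₀ y₀) * M, fun x' =>
        ⟨mul_le_mul_of_nonneg_left (hFM _).1 hpos.le, mul_le_mul_of_nonneg_left (hFM _).2 hpos.le⟩⟩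
      ⟨δ, hδ, N, fun _ => hGN _⟩ (fun x' y' => ?_)
    · rw [integral_const_mul, Real.exp_neg, mul_assoc, inv_mul_le_iff₀ (Real.exp_pos _)] at this
      simpa using this
    · have := hFG (Fin.cons x₀ x') (Fin.cons y₀ y')
      simp only [Fin.sum_univ_succ, Fin.cons_zero, Fin.cons_succ, Real.exp_add] at this
      rw [Real.exp_neg, mul_assoc, inv_mul_le_iff₀ (Real.exp_pos _)]
      exact this

/-- Property `(τ)` bounds the product of the measures of two sets at positive cost distance. -/
lemma PropertyTau.measure_mul_measure_le {X : Type*} [MeasurableSpace X] {μ : Measure X}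
    [IsProbabilityMeasure μ] {c : X → X → ℝ} (h : PropertyTau μ c) (hc : ∀ x y, 0 ≤ c x y)
    {A B : Set X} (hA : MeasurableSet A) (hB : MeasurableSet B) {r : ℝ} (hr : 0 ≤ r)
    (hAB : ∀ x ∈ B, ∀ y ∈ A, r ≤ c x y) : μ.real A * μ.real B ≤ Real.exp (-r) := by
  classical
  have he : 1 ≤ Real.exp r := Real.one_le_exp hr
  have he' : Real.exp (-r) ≤ 1 := Real.exp_le_one_iff.2 (by linarith)
  have hpos := Real.exp_pos (-r)
  -- `F x * G y` exceeds 1 only on `B × A`, where it equals `e^r`. The value `e^{-r}` of `G` off `A`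
  -- offsets `F` on `B` and keeps `G` bounded below.
  let F : X → ℝ := fun x => if x ∈ B then Real.exp r else 1
  let G : X → ℝ := fun x => if x ∈ A then 1 else Real.exp (-r)
  have hF : Measurable F := Measurable.ite hB measurable_const measurable_const
  have hG : Measurable G := Measurable.ite hA measurable_const measurable_const
  have hFI : ∀ x, F x ∈ Set.Icc 1 (Real.exp r) := fun x => by
    simp only [F]; split_ifs <;> simp [hr]
  have hGI : ∀ x, G x ∈ Set.Icc (Real.exp (-r)) 1 := fun x => by
    simp only [G]; split_ifs <;> simp [hr]
  have hFG := h F G hF hG ⟨1, one_pos, _, hFI⟩ ⟨_, hpos, 1, hGI⟩ fun x y => by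
    have h0 : 1 ≤ Real.exp (c x y) := Real.one_le_exp (hc x y)
    by_cases hx : x ∈ B <;> by_cases hy : y ∈ A
    · simp only [F, G, if_pos hx, if_pos hy, mul_one]
      exact Real.exp_le_exp.2 (hAB x hx y hy)
    · simpa only [F, G, if_pos hx, if_neg hy, ← Real.exp_add, add_neg_cancel, Real.exp_zero] using h0
    · simpa only [F, G, if_neg hx, if_pos hy, mul_one] using h0
    · simp only [F, G, if_neg hx, if_neg hy, one_mul]
      exact he'.trans h0
  have hBF : Real.exp r * μ.real B ≤ ∫ x, F x ∂μ := by
    have h1 : ∫ x, B.indicator (fun _ => Real.exp r) x ∂μ = Real.exp r * μ.real B := by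
      rw [integral_indicator hB, setIntegral_const, smul_eq_mul, mul_comm]
    rw [← h1]
    refine integral_mono ((integrable_const _).indicator hB) (integrable_of_mem_Icc hF hFI) ?_
    intro x
    by_cases hx : x ∈ B
    · simp [F, hx]
    · simp [F, hx]
  have hAG : μ.real A ≤ ∫ x, G x ∂μ := by
    have h1 : ∫ x, A.indicator (fun _ => (1 : ℝ)) x ∂μ = μ.real A := by
      rw [integral_indicator hA, setIntegral_const, smul_eq_mul, mul_one]
    rw [← h1]
    refine integral_mono ((integrable_const _).indicator hA) (integrable_of_mem_Icc hG hGI) ?_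
    intro x
    by_cases hx : x ∈ A
    · simp [G, hx]
    · simpa [G, hx] using hpos.le
  have h2 : Real.exp r * μ.real B * μ.real A ≤ 1 :=
    (mul_le_mul hBF hAG measureReal_nonneg (zero_le_one.trans (integral_mem_Icc hF hFI).1)).trans hFG
  rw [Real.exp_neg, ← one_div, le_div_iff₀ (Real.exp_pos r)]
  linarith

end PropertyTau

/-! ### From transport to property `(τ)` and concentration. -/

section Duality

variable {d : ℕ}

lemma continuous_sum_twoLevelCost {p : ℝ} (hp : 0 ≤ p) :
    Continuous fun z : (Fin d → ℝ) × (Fin d → ℝ) => ∑ j, twoLevelCost p (z.1 j - z.2 j) :=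
  continuous_finsetSum _ fun j _ => (continuous_twoLevelCost hp).comp (by fun_prop)

/-- The easy half of Kantorovich duality. -/
lemma ofReal_integral_sub_integral_le_transportCost {p : ℝ}
    {ν₁ ν₂ : Measure (Fin d → ℝ)} {φ ψ : (Fin d → ℝ) → ℝ} (hφ : Integrable φ ν₁)
    (hψ : Integrable ψ ν₂) (h : ∀ x y, φ x - ψ y ≤ ∑ j, twoLevelCost p (x j - y j)) :
    ENNReal.ofReal (∫ x, φ x ∂ν₁ - ∫ x, ψ x ∂ν₂) ≤ transportCost p ν₁ ν₂ := by
  refine le_iInf₂ fun π hπ => ?_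
  obtain ⟨rfl, rfl⟩ := hπ
  have h1 : Integrable (fun z : (Fin d → ℝ) × (Fin d → ℝ) => φ z.1) π :=
    hφ.comp_measurable measurable_fst
  have h2 : Integrable (fun z : (Fin d → ℝ) × (Fin d → ℝ) => ψ z.2) π :=
    hψ.comp_measurable measurable_snd
  rw [Measure.fst, integral_map measurable_fst.aemeasurable hφ.aestronglyMeasurable, Measure.snd,
    integral_map measurable_snd.aemeasurable hψ.aestronglyMeasurable, ← integral_sub h1 h2]
  calc _ ≤ ∫⁻ z, ENNReal.ofReal (φ z.1 - ψ z.2) ∂π := by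
        refine ENNReal.ofReal_le_of_le_toReal ?_
        refine (integral_eq_lintegral_pos_part_sub_lintegral_neg_part (h1.sub h2)).trans_le ?_
        exact sub_le_self _ ENNReal.toReal_nonneg
    _ ≤ _ := lintegral_mono fun z => ENNReal.ofReal_le_ofReal (h z.1 z.2)

lemma klDiv_tilted {X : Type*} [MeasurableSpace X] {μ : Measure X} [IsProbabilityMeasure μ]
    {f : X → ℝ} (hf : Measurable f) {a b : ℝ} (hab : ∀ x, f x ∈ Set.Icc a b) :
    InformationTheory.klDiv (μ.tilted f) μ =
      ENNReal.ofReal (∫ x, f x ∂(μ.tilted f) - Real.log (∫ x, Real.exp (f x) ∂μ)) := by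
  have hexp : Integrable (fun x => Real.exp (f x)) μ :=
    integrable_of_mem_Icc hf.exp fun x =>
      ⟨Real.exp_le_exp.2 (hab x).1, Real.exp_le_exp.2 (hab x).2⟩
  have := isProbabilityMeasure_tilted hexp
  have hac := tilted_absolutelyContinuous μ f
  have hllr : llr (μ.tilted f) μ =ᵐ[μ.tilted f]
      fun x => f x - Real.log (∫ x, Real.exp (f x) ∂μ) :=
    hac.ae_le (log_rnDeriv_tilted_left_self hexp)
  have hfi := integrable_of_mem_Icc (μ := μ.tilted f) hf hab
  have hi : Integrable (llr (μ.tilted f) μ) (μ.tilted f) :=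
    (integrable_congr hllr).2 (hfi.sub (integrable_const _))
  rw [InformationTheory.klDiv_of_ac_of_integrable hac hi, integral_congr_ae hllr,
    integral_sub hfi (integrable_const _)]
  simp

/-- Bobkov–Götze argument: for `ν` the tilting of `μ` by `φ / C`, `C * H(ν|μ)` is `∫ φ dν - C log ∫
e^{φ/C} dμ`, and `∫ φ dν` cancels against the dual lower bound for the cost. -/
lemma TransportInequality.integral_exp_le {p C : ℝ} (hC : 0 < C) {μ : Measure (Fin d → ℝ)}
    [IsProbabilityMeasure μ] (h : TransportInequality μ p C) {φ ψ : (Fin d → ℝ) → ℝ}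
    (hφ : Measurable φ) (hψ : Measurable ψ) {a b a' b' : ℝ} (hφI : ∀ x, φ x ∈ Set.Icc a b)
    (hψI : ∀ x, ψ x ∈ Set.Icc a' b')
    (hφψ : ∀ x y, φ x - ψ y ≤ ∑ j, twoLevelCost p (x j - y j)) :
    ∫ x, Real.exp (φ x / C) ∂μ ≤ Real.exp ((∫ x, ψ x ∂μ) / C) := by
  have hfI : ∀ x, φ x / C ∈ Set.Icc (a / C) (b / C) := fun x =>
    ⟨by gcongr; exact (hφI x).1, by gcongr; exact (hφI x).2⟩
  have hf : Measurable fun x => φ x / C := hφ.div_const C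
  have hexpI : ∀ x, Real.exp (φ x / C) ∈ Set.Icc (Real.exp (a / C)) (Real.exp (b / C)) := fun x =>
    ⟨Real.exp_le_exp.2 (hfI x).1, Real.exp_le_exp.2 (hfI x).2⟩
  have hexp := integrable_of_mem_Icc (μ := μ) hf.exp hexpI
  have hν := isProbabilityMeasure_tilted hexp
  have hZ : 0 < ∫ x, Real.exp (φ x / C) ∂μ := integral_exp_pos hexp
  have h1 := (ofReal_integral_sub_integral_le_transportCost
    (integrable_of_mem_Icc hφ hφI) (integrable_of_mem_Icc hψ hψI) hφψ).trans (h _ hν)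
  rw [klDiv_tilted hf hfI, ← ENNReal.ofReal_mul hC.le, integral_div] at h1
  -- `ENNReal.ofReal` truncates at zero, so it can be removed only because the relative entropy is
  -- nonnegative.
  have h0 : 0 ≤ C * ((∫ x, φ x ∂(μ.tilted fun x => φ x / C)) / C -
      Real.log (∫ x, Real.exp (φ x / C) ∂μ)) := by
    have hac := tilted_absolutelyContinuous μ fun x => φ x / C
    have hfi := integrable_of_mem_Icc (μ := μ.tilted fun x => φ x / C) hf hfI
    have hllr : llr (μ.tilted fun x => φ x / C) μ =ᵐ[μ.tilted fun x => φ x / C]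
        fun x => φ x / C - Real.log (∫ x, Real.exp (φ x / C) ∂μ) :=
      hac.ae_le (log_rnDeriv_tilted_left_self hexp)
    have h2 := InformationTheory.integral_llr_add_sub_measure_univ_nonneg hac
      ((integrable_congr hllr).2 (hfi.sub (integrable_const _)))
    rw [integral_congr_ae hllr, integral_sub hfi (integrable_const _), integral_div] at h2
    simp only [integral_const, probReal_univ, one_smul, add_sub_cancel_right] at h2
    positivity
  have h2 := (ENNReal.ofReal_le_ofReal_iff h0).1 h1
  rw [mul_sub, mul_div_cancel₀ _ hC.ne'] at h2
  rw [← Real.log_le_iff_le_exp hZ, le_div_iff₀ hC]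
  linarith

/-- With `φ = C log F` and `ψ = -C log G`, `φ x - ψ z ≤ c x z / 2 ≤ c x y + c y z`. Hence an
intermediate `m` satisfies `φ - m ≤ c` and `m - ψ ≤ c`. The exponential bounds for `(φ, m)` and
`(-ψ, -m)` multiply to 1. -/
theorem TransportInequality.propertyTau {p C : ℝ} (hp : p ∈ Set.Icc (1 : ℝ) 2) (hC : 0 < C)
    {μ : Measure (Fin d → ℝ)} [IsProbabilityMeasure μ] (h : TransportInequality μ p C) :
    PropertyTau μ fun x y => (∑ j, twoLevelCost p (x j - y j)) / (2 * C) := by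
  rintro F G hF hG ⟨ε, hε, M, hFM⟩ ⟨δ, hδ, N, hGN⟩ hFG
  have hFpos : ∀ x, 0 < F x := fun x => hε.trans_le (hFM x).1
  have hGpos : ∀ x, 0 < G x := fun x => hδ.trans_le (hGN x).1
  set c : (Fin d → ℝ) → (Fin d → ℝ) → ℝ := fun x y => ∑ j, twoLevelCost p (x j - y j) with hc
  have hc0 : ∀ x y, 0 ≤ c x y := fun x y =>
    Finset.sum_nonneg fun j _ => twoLevelCost_nonneg p _
  have hctri : ∀ x y z, c x z ≤ 2 * c x y + 2 * c y z := by
    intro x y z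
    simp only [hc, Finset.mul_sum, ← Finset.sum_add_distrib]
    refine Finset.sum_le_sum fun j _ => ?_
    have := twoLevelCost_add_le hp (x j - y j) (y j - z j)
    rwa [sub_add_sub_cancel] at this
  let φ : (Fin d → ℝ) → ℝ := fun x => C * Real.log (F x)
  let ψ : (Fin d → ℝ) → ℝ := fun x => -(C * Real.log (G x))
  have hφψ : ∀ x z, φ x - ψ z ≤ c x z / 2 := by
    intro x z
    have h1 := Real.log_le_log (mul_pos (hFpos x) (hGpos z)) (hFG x z)
    rw [Real.log_mul (hFpos x).ne' (hGpos z).ne', Real.log_exp, le_div_iff₀ (by positivity)] at h1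
    simp only [φ, ψ]
    linarith
  have hφI : ∀ x, φ x ∈ Set.Icc (C * Real.log ε) (C * Real.log M) := fun x =>
    ⟨mul_le_mul_of_nonneg_left (Real.log_le_log hε (hFM x).1) hC.le,
      mul_le_mul_of_nonneg_left (Real.log_le_log (hFpos x) (hFM x).2) hC.le⟩
  have hψI : ∀ x, ψ x ∈ Set.Icc (-(C * Real.log N)) (-(C * Real.log δ)) := fun x =>
    ⟨neg_le_neg (mul_le_mul_of_nonneg_left (Real.log_le_log (hGpos x) (hGN x).2) hC.le),
      neg_le_neg (mul_le_mul_of_nonneg_left (Real.log_le_log hδ (hGN x).1) hC.le)⟩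
  have hφm : Measurable φ := (Real.measurable_log.comp hF).const_mul C
  have hψm : Measurable ψ := ((Real.measurable_log.comp hG).const_mul C).neg
  -- The intermediate function is an infimum of continuous functions, so it is measurable.
  let m : (Fin d → ℝ) → ℝ := fun y => ⨅ z, (ψ z + c y z)
  have hbdd : ∀ y, BddBelow (Set.range fun z => ψ z + c y z) := fun y =>
    ⟨-(C * Real.log N), by rintro _ ⟨z, rfl⟩; exact (hψI z).1.trans (by linarith [hc0 y z])⟩
  have hmm : Measurable m := by
    refine UpperSemicontinuous.measurable (upperSemicontinuous_ciInf hbdd fun z => ?_)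
    refine Continuous.upperSemicontinuous (continuous_const.add ?_)
    exact (continuous_sum_twoLevelCost (by linarith [hp.1])).comp
      (continuous_id.prodMk continuous_const)
  have hmψ : ∀ y z, m y - ψ z ≤ c y z := fun y z => by
    linarith [ciInf_le (hbdd y) z]
  have hmI : ∀ y, m y ∈ Set.Icc (-(C * Real.log N)) (-(C * Real.log δ)) := by
    refine fun y => ⟨le_ciInf fun z => (hψI z).1.trans (by linarith [hc0 y z]), ?_⟩
    have h1 := hmψ y y
    have h2 : c y y = 0 := by simp [hc, twoLevelCost, Real.zero_rpow (by linarith [hp.1] : p ≠ 0)]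
    linarith [(hψI y).2]
  have hφmle : ∀ x y, φ x - m y ≤ c x y := by
    intro x y
    have : φ x - c x y ≤ m y := le_ciInf fun z => by
      linarith [hφψ x z, hctri x y z]
    linarith
  have h1 := h.integral_exp_le hC hφm hmm hφI hmI hφmle
  have h2 := h.integral_exp_le hC (φ := fun x => -ψ x) (ψ := fun x => -m x) hψm.neg hmm.neg
    (fun x => ⟨neg_le_neg (hψI x).2, neg_le_neg (hψI x).1⟩)
    (fun x => ⟨neg_le_neg (hmI x).2, neg_le_neg (hmI x).1⟩) (fun x y => by
      simp_rw [twoLevelCost_sub_comm p (x _)]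
      linarith [hmψ y x])
  have hFe : ∀ x, Real.exp (φ x / C) = F x := fun x => by
    simp only [φ, mul_div_cancel_left₀ _ hC.ne', Real.exp_log (hFpos x)]
  have hGe : ∀ x, Real.exp (-ψ x / C) = G x := fun x => by
    simp only [ψ, neg_neg, mul_div_cancel_left₀ _ hC.ne', Real.exp_log (hGpos x)]
  simp only [hFe] at h1
  simp only [hGe, integral_neg] at h2
  calc _ ≤ Real.exp ((∫ x, m x ∂μ) / C) * Real.exp (-(∫ x, m x ∂μ) / C) :=
        mul_le_mul h1 h2 (integral_nonneg fun x => (hGpos x).le) (Real.exp_pos _).le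
    _ = 1 := by rw [← Real.exp_add, neg_div, add_neg_cancel, Real.exp_zero]

theorem TransportInequality.twoLevelConcentration {p C : ℝ} (hp : p ∈ Set.Icc (1 : ℝ) 2)
    (hC : 0 < C) {μ : Measure (Fin d → ℝ)} [IsProbabilityMeasure μ]
    (h : TransportInequality μ p C) : TwoLevelConcentration μ p (1 / (2 * C)) 2 := by
  intro n A hA hA2 r hr
  set S := A + √r • lqUnitBall n d 2 + r ^ (1 / p) • lqUnitBall n d p with hS
  set P := Measure.pi fun _ : Fin n => μ with hP
  -- A measurable hull replaces `S`, whose measurability is not known; it has the same measure, and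
  -- its complement is still at cost at least `r` from `A`.
  have hSm := measurableSet_toMeasurable P S
  have hle := ((h.propertyTau hp hC).pi n).measure_mul_measure_le
    (fun x y => Finset.sum_nonneg fun i _ => div_nonneg
      (Finset.sum_nonneg fun j _ => twoLevelCost_nonneg p _) (by positivity))
    hA hSm.compl (r := r / (2 * C)) (by positivity) (fun x hx y hy => by
      rw [← Finset.sum_div]
      gcongr
      by_contra! hlt
      exact hx (subset_toMeasurable P S (mem_enlargement_of_cost_le hp hr hy hlt.le)))
  have hSr : P.real (toMeasurable P S) = P.real S := by
    simp [Measure.real]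
  rw [probReal_compl_eq_one_sub hSm, hSr] at hle
  have h1 : 0 ≤ 1 - P.real S := by linarith [measureReal_le_one (μ := P) (s := S)]
  have h2 : -(1 / (2 * C)) * r = -(r / (2 * C)) := by ring
  rw [h2]
  nlinarith

end Duality

/-! ### Laws of large numbers for empirical measures. -/

section Empirical

open Filter Topology ProbabilityTheory

variable {X : Type*} [MeasurableSpace X]

/-- The uniform probability measure on `Fin (n + 1)`. -/
noncomputable def uniformFin (n : ℕ) : ProbabilityMeasure (Fin (n + 1)) :=
  ⟨(PMF.uniformOfFintype (Fin (n + 1))).toMeasure, inferInstance⟩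

/-- The empirical measure of a nonempty finite sequence of points. -/
noncomputable def empirical {n : ℕ} (x : Fin (n + 1) → X) : ProbabilityMeasure X :=
  (uniformFin n).map (f := x) (measurable_of_finite x).aemeasurable

lemma empirical_map {Y : Type*} [MeasurableSpace Y] {n : ℕ} (x : Fin (n + 1) → X) {f : X → Y}
    (hf : Measurable f) : (empirical x).map hf.aemeasurable = empirical (f ∘ x) := by
  refine Subtype.ext ?_
  simp only [empirical]
  exact Measure.map_map hf (measurable_of_finite x)

lemma integral_empirical {n : ℕ} (x : Fin (n + 1) → X) {f : X → ℝ} (hf : Measurable f) :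
    ∫ z, f z ∂(empirical x : Measure X) = (∑ i, f (x i)) / (n + 1 : ℕ) := by
  rw [empirical, ProbabilityMeasure.toMeasure_map,
    integral_map (measurable_of_finite x).aemeasurable hf.aestronglyMeasurable]
  simp only [uniformFin, ProbabilityMeasure.coe_mk]
  rw [PMF.integral_eq_sum]
  simp only [PMF.uniformOfFintype_apply, Fintype.card_fin, smul_eq_mul, ENNReal.toReal_inv,
    ENNReal.toReal_natCast, ← Finset.mul_sum, div_eq_inv_mul]

lemma lintegral_empirical_ofReal {n : ℕ} (x : Fin (n + 1) → X) {f : X → ℝ} (hf : Measurable f)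
    (hf0 : ∀ z, 0 ≤ f z) :
    ∫⁻ z, ENNReal.ofReal (f z) ∂(empirical x : Measure X) =
      ENNReal.ofReal ((∑ i, f (x i)) / (n + 1 : ℕ)) := by
  rw [← integral_empirical x hf, ofReal_integral_eq_lintegral_ofReal _ (ae_of_all _ hf0)]
  rw [empirical, ProbabilityMeasure.toMeasure_map,
    integrable_map_measure hf.aestronglyMeasurable (measurable_of_finite x).aemeasurable]
  exact Integrable.of_finite

/-- The weak law of large numbers for the coordinates of a finite product. -/
lemma tendsto_measure_average_sub_integral {μ : Measure X} [IsProbabilityMeasure μ] {f : X → ℝ}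
    (hf : Measurable f) (hfi : Integrable f μ) {ε : ℝ} (hε : 0 < ε) :
    Tendsto (fun n : ℕ => (Measure.pi fun _ : Fin (n + 1) => μ)
      {x | ε ≤ |(∑ i, f (x i)) / (n + 1 : ℕ) - ∫ z, f z ∂μ|}) atTop (𝓝 0) := by
  -- The strong law is applied on the infinite product, then projected to the first `n + 1`
  -- coordinates.
  let P : Measure (ℕ → X) := Measure.infinitePi fun _ => μ
  have hmp : ∀ i, MeasurePreserving (fun ω : ℕ → X => ω i) P μ := fun i =>
    ⟨measurable_pi_apply i, Measure.infinitePi_map_eval _ i⟩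
  have hind0 : iIndepFun (fun (i : ℕ) (ω : ℕ → X) => ω i) P :=
    iIndepFun_infinitePi (X := fun _ x => x) fun _ => measurable_id
  have hind : iIndepFun (fun (i : ℕ) (ω : ℕ → X) => f (ω i)) P :=
    hind0.comp (fun _ => f) fun _ => hf
  have hint : Integrable (fun ω : ℕ → X => f (ω 0)) P := (hmp 0).integrable_comp_of_integrable hfi
  have hae := strong_law_ae_real (fun (i : ℕ) (ω : ℕ → X) => f (ω i)) hint
    (fun i j hij => hind.indepFun hij) fun i =>
      ⟨(hf.comp (measurable_pi_apply i)).aemeasurable,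
        (hf.comp (measurable_pi_apply 0)).aemeasurable, by
          rw [← Function.comp_def f, ← Function.comp_def f,
            ← Measure.map_map hf (measurable_pi_apply i),
            ← Measure.map_map hf (measurable_pi_apply 0), (hmp i).map_eq, (hmp 0).map_eq]⟩
  have hE : P[fun ω : ℕ → X => f (ω 0)] = ∫ z, f z ∂μ := by
    rw [← (hmp 0).map_eq,
      integral_map (measurable_pi_apply 0).aemeasurable hf.aestronglyMeasurable]
  rw [hE] at hae
  have hm := tendstoInMeasure_of_tendsto_ae (fun n => ((Finset.measurable_sum _ fun i _ =>
    hf.comp (measurable_pi_apply i)).div_const _).aestronglyMeasurable) hae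
  have h1 := (hm (ENNReal.ofReal ε) (by simpa using hε)).comp (tendsto_add_atTop_nat 1)
  refine h1.congr fun n => ?_
  have hpi : P.map (fun ω (i : Fin (n + 1)) => ω i) = Measure.pi fun _ : Fin (n + 1) => μ := by
    have := (iIndepFun_iff_map_fun_eq_pi_map (fun i => (measurable_pi_apply _).aemeasurable)).1
      (hind0.precomp (g := fun i : Fin (n + 1) => (i : ℕ)) Fin.val_injective)
    rw [this]
    congr 1
    ext1 i
    exact (hmp i).map_eq
  rw [← hpi, Measure.map_apply (by fun_prop) (measurableSet_le measurable_const (by fun_prop))]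
  simp only [Function.comp_apply, Set.preimage_ofPred_eq]
  congr 1
  ext ω
  simp only [Set.mem_ofPred_eq]
  rw [edist_dist, ENNReal.ofReal_le_ofReal_iff dist_nonneg, Real.dist_eq,
    Finset.sum_range fun i => f (ω i)]

/-- Empirical measures converge weakly in probability. -/
lemma tendsto_measure_empirical_notMem [TopologicalSpace X] [OpensMeasurableSpace X]
    {μ : ProbabilityMeasure X} {V : Set (ProbabilityMeasure X)} (hV : V ∈ 𝓝 μ) :
    Tendsto (fun n : ℕ => (Measure.pi fun _ : Fin (n + 1) => (μ : Measure X))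
      {x | empirical x ∉ V}) atTop (𝓝 0) := by
  -- The sets satisfying the conclusion form a filter. Convergence of `id` along it can be tested on
  -- one bounded continuous function at a time, where it is the weak law.
  let F : Filter (ProbabilityMeasure X) :=
    { sets := {V | Tendsto (fun n : ℕ => (Measure.pi fun _ : Fin (n + 1) => (μ : Measure X))
        {x | empirical x ∉ V}) atTop (𝓝 0)}
      univ_sets := by simp
      sets_of_superset := fun {V W} hV hVW =>
        tendsto_of_tendsto_of_tendsto_of_le_of_le tendsto_const_nhds hV (fun _ => zero_le)
          fun n => measure_mono fun x hx hxV => hx (hVW hxV)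
      inter_sets := fun {V W} hV hW => by
        refine tendsto_of_tendsto_of_tendsto_of_le_of_le tendsto_const_nhds
          (by simpa using Tendsto.add hV hW) (fun _ => zero_le) fun n =>
            (measure_mono ?_).trans (measure_union_le _ _)
        intro x hx
        by_cases h : empirical x ∈ V
        · exact Or.inr fun h' => hx ⟨h, h'⟩
        · exact Or.inl h }
  have hF : Tendsto id F (𝓝 μ) := by
    rw [ProbabilityMeasure.tendsto_iff_forall_integral_tendsto]
    intro f
    rw [Metric.tendsto_nhds]
    intro ε hε
    have hfm : Measurable f := f.continuous.measurable
    refine (tendsto_measure_average_sub_integral hfm (f.integrable (μ : Measure X)) hε).congr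
      fun n => ?_
    congr 1
    ext x
    simp [integral_empirical x hfm, Real.dist_eq]
  exact hF hV

end Empirical

/-! ### Change of measure on product spaces. -/

section ChangeOfMeasure

open ProbabilityTheory

variable {X : Type*} [MeasurableSpace X]

lemma lintegral_pi_prod {μ : Measure X} [IsProbabilityMeasure μ] {n : ℕ}
    {g : Fin n → X → ℝ≥0∞} (hg : ∀ i, Measurable (g i)) :
    ∫⁻ x, ∏ i, g i (x i) ∂(Measure.pi fun _ : Fin n => μ) = ∏ i, ∫⁻ z, g i z ∂μ := by
  have hind : iIndepFun (fun i (x : Fin n → X) => g i (x i)) (Measure.pi fun _ : Fin n => μ) :=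
    iIndepFun_pi fun i => (hg i).aemeasurable
  have := lintegral_prod_eq_prod_lintegral_of_indepFun Finset.univ _ hind
    fun i => (hg i).comp (measurable_pi_apply i)
  rw [this]
  refine Finset.prod_congr rfl fun i _ => ?_
  exact (measurePreserving_eval (fun _ : Fin n => μ) i).lintegral_comp (hg i)

lemma pi_withDensity {μ : Measure X} [IsProbabilityMeasure μ] {n : ℕ} {g : X → ℝ≥0∞}
    (hg : Measurable g) [SigmaFinite (μ.withDensity g)] :
    (Measure.pi fun _ : Fin n => μ.withDensity g) =
      (Measure.pi fun _ : Fin n => μ).withDensity fun x => ∏ i, g (x i) := by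
  classical
  refine Measure.pi_eq fun s hs => ?_
  rw [withDensity_apply _ (MeasurableSet.univ_pi hs),
    ← lintegral_indicator (MeasurableSet.univ_pi hs)]
  have : ∀ x : Fin n → X, (Set.univ.pi s).indicator (fun x => ∏ i, g (x i)) x =
      ∏ i, (s i).indicator g (x i) := by
    intro x
    by_cases hx : x ∈ Set.univ.pi s
    · rw [Set.indicator_of_mem hx]
      exact Finset.prod_congr rfl fun i _ =>
        (Set.indicator_of_mem (hx i (Set.mem_univ i)) g).symm
    · rw [Set.indicator_of_notMem hx]
      simp only [Set.mem_univ_pi, not_forall] at hx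
      obtain ⟨i, hi⟩ := hx
      exact (Finset.prod_eq_zero (Finset.mem_univ i) (Set.indicator_of_notMem hi g)).symm
  simp_rw [this]
  rw [lintegral_pi_prod fun i => hg.indicator (hs i)]
  refine Finset.prod_congr rfl fun i _ => ?_
  rw [lintegral_indicator (hs i), withDensity_apply _ (hs i)]

lemma pi_measure_le_of_sum_llr_le {μ ν : Measure X} [IsProbabilityMeasure μ]
    [IsProbabilityMeasure ν] (hac : ν ≪ μ) {n : ℕ} {B : Set (Fin n → X)} (hB : MeasurableSet B)
    {K : ℝ} (h : ∀ x ∈ B, ∑ i, llr ν μ (x i) ≤ K) :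
    (Measure.pi fun _ : Fin n => ν) B ≤
      ENNReal.ofReal (Real.exp K) * (Measure.pi fun _ : Fin n => μ) B := by
  let g : X → ℝ≥0∞ := fun z => ENNReal.ofReal (ν.rnDeriv μ z).toReal
  have hg : Measurable g := (Measure.measurable_rnDeriv ν μ).ennreal_toReal.ennreal_ofReal
  have hν : μ.withDensity g = ν := by
    conv_rhs => rw [← Measure.withDensity_rnDeriv_eq ν μ hac]
    refine withDensity_congr_ae ?_
    filter_upwards [Measure.rnDeriv_lt_top ν μ] with z hz using ENNReal.ofReal_toReal hz.ne
  -- Only an inequality: where the density vanishes, `Real.log 0 = 0` makes the right side 1.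
  have hgle : ∀ z, g z ≤ ENNReal.ofReal (Real.exp (llr ν μ z)) := fun z =>
    ENNReal.ofReal_le_ofReal (by rw [llr]; exact Real.le_exp_log _)
  have : SigmaFinite (μ.withDensity g) := by rw [hν]; infer_instance
  have hpi := pi_withDensity (μ := μ) (n := n) hg
  simp only [hν] at hpi
  rw [hpi, withDensity_apply _ hB, ← setLIntegral_const]
  refine setLIntegral_mono measurable_const fun x hx => ?_
  calc ∏ i, g (x i) ≤ ∏ i, ENNReal.ofReal (Real.exp (llr ν μ (x i))) :=
        Finset.prod_le_prod' fun i _ => hgle _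
    _ = ENNReal.ofReal (Real.exp (∑ i, llr ν μ (x i))) := by
        rw [Real.exp_sum, ENNReal.ofReal_prod_of_nonneg fun i _ => (Real.exp_pos _).le]
    _ ≤ _ := ENNReal.ofReal_le_ofReal (Real.exp_le_exp.2 (h x hx))

end ChangeOfMeasure

/-! ### From concentration to transport. -/

section Concentration

open Filter Topology ProbabilityTheory

variable {d : ℕ}

lemma TwoLevelConcentration.exists_empirical_near {p a b : ℝ} (hp : p ∈ Set.Icc (1 : ℝ) 2)
    (ha : 0 < a) {μ ν : ProbabilityMeasure (Fin d → ℝ)}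
    (h : TwoLevelConcentration (μ : Measure (Fin d → ℝ)) p a b)
    (hac : (ν : Measure (Fin d → ℝ)) ≪ μ)
    (hint : Integrable (llr (ν : Measure (Fin d → ℝ)) μ) (ν : Measure (Fin d → ℝ)))
    {V W : Set (ProbabilityMeasure (Fin d → ℝ))} (hV : V ∈ 𝓝 μ) (hW : W ∈ 𝓝 ν)
    {ε : ℝ} (hε : 0 < ε) :
    ∃ (n : ℕ) (x y : Fin (n + 1) → Fin d → ℝ), empirical x ∈ V ∧ empirical y ∈ W ∧
      (∑ i, ∑ j, twoLevelCost p (y i j - x i j)) / (n + 1 : ℕ) ≤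
        4 * ((∫ z, llr (ν : Measure (Fin d → ℝ)) μ z ∂(ν : Measure (Fin d → ℝ)) + 2 * ε) / a) := by
  set H := ∫ z, llr (ν : Measure (Fin d → ℝ)) μ z ∂(ν : Measure (Fin d → ℝ)) with hH
  have hH0 : 0 ≤ H := by
    simpa using InformationTheory.integral_llr_add_sub_measure_univ_nonneg hac hint
  have hllr : Measurable (llr (ν : Measure (Fin d → ℝ)) μ) := measurable_llr _ _
  have e1 := (tendsto_measure_empirical_notMem hV).eventually_le_const
    (show (0 : ℝ≥0∞) < ENNReal.ofReal (1 / 2) by simp)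
  have e2 := (tendsto_measure_empirical_notMem hW).eventually_le_const
    (show (0 : ℝ≥0∞) < ENNReal.ofReal (1 / 4) by simp)
  have e3 := (tendsto_measure_average_sub_integral hllr hint hε).eventually_le_const
    (show (0 : ℝ≥0∞) < ENNReal.ofReal (1 / 4) by simp)
  have e4 : ∀ᶠ n : ℕ in atTop, b * Real.exp (-(((n + 1 : ℕ) : ℝ) * ε)) < 1 / 2 := by
    have t1 : Tendsto (fun n : ℕ => ((n + 1 : ℕ) : ℝ) * ε) atTop atTop :=
      (tendsto_natCast_atTop_atTop.comp (tendsto_add_atTop_nat 1)).atTop_mul_const hε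
    have t2 := (Real.tendsto_exp_neg_atTop_nhds_zero.comp t1).const_mul b
    rw [mul_zero] at t2
    exact t2.eventually_lt_const (by norm_num)
  obtain ⟨n, h1, h2, h3, h4⟩ := (e1.and (e2.and (e3.and e4))).exists
  set N : ℝ := ((n + 1 : ℕ) : ℝ) with hN
  have hNpos : 0 < N := by positivity
  set P := Measure.pi fun _ : Fin (n + 1) => (μ : Measure (Fin d → ℝ)) with hP
  set Q := Measure.pi fun _ : Fin (n + 1) => (ν : Measure (Fin d → ℝ)) with hQ
  set A := (toMeasurable P {x | empirical x ∉ V})ᶜ with hA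
  set D := {y : Fin (n + 1) → Fin d → ℝ |
    ε ≤ |(∑ i, llr (ν : Measure (Fin d → ℝ)) μ (y i)) / N - H|} with hD
  set E := toMeasurable Q {x | empirical x ∉ W} with hE
  have hDm : MeasurableSet D := by
    refine measurableSet_le measurable_const ?_
    exact (((Finset.measurable_sum _ fun i _ =>
      hllr.comp (measurable_pi_apply i)).div_const _).sub_const _).abs
  have hEm : MeasurableSet E := measurableSet_toMeasurable _ _
  have hAm : MeasurableSet A := (measurableSet_toMeasurable _ _).compl
  have hBm : MeasurableSet (E ∪ D)ᶜ := (hEm.union hDm).compl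
  have hAP : 1 / 2 ≤ P.real A := by
    rw [hA, probReal_compl_eq_one_sub (measurableSet_toMeasurable _ _)]
    have : P.real (toMeasurable P {x | empirical x ∉ V}) ≤ 1 / 2 := by
      rw [Measure.real, measure_toMeasurable]
      exact ENNReal.toReal_le_of_le_ofReal (by norm_num) h1
    linarith
  have hBQ : 1 / 2 ≤ Q.real (E ∪ D)ᶜ := by
    rw [probReal_compl_eq_one_sub (hEm.union hDm)]
    have hEle : Q.real E ≤ 1 / 4 := by
      rw [Measure.real, measure_toMeasurable]
      exact ENNReal.toReal_le_of_le_ofReal (by norm_num) h2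
    have hDle : Q.real D ≤ 1 / 4 := ENNReal.toReal_le_of_le_ofReal (by norm_num) h3
    linarith [measureReal_union_le (μ := Q) E D]
  have hBP : Q.real (E ∪ D)ᶜ ≤ Real.exp (N * (H + ε)) * P.real (E ∪ D)ᶜ := by
    have h5 := pi_measure_le_of_sum_llr_le hac hBm (K := N * (H + ε)) fun y hy => by
      have hy' : ¬ ε ≤ |(∑ i, llr (ν : Measure (Fin d → ℝ)) μ (y i)) / N - H| :=
        fun hy' => hy (Or.inr hy')
      have h6 := (abs_lt.1 (not_le.1 hy')).2
      rw [sub_lt_iff_lt_add', div_lt_iff₀ hNpos] at h6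
      linarith
    have h7 := ENNReal.toReal_mono (by finiteness) h5
    rwa [ENNReal.toReal_mul, ENNReal.toReal_ofReal (Real.exp_pos _).le] at h7
  -- Chosen so that `e^{N(H+ε)} * b e^{-ar} = b e^{-Nε}`, which is below the lower bound `1 / 2` for
  -- `Q.real (E ∪ D)ᶜ`.
  set r := N * (H + 2 * ε) / a with hr
  have hr0 : 0 ≤ r := by positivity
  have hconc := h (n + 1) A hAm hAP r hr0
  set S := A + √r • lqUnitBall (n + 1) d 2 + r ^ (1 / p) • lqUnitBall (n + 1) d p with hS
  have hex : ∃ y ∈ S, y ∈ (E ∪ D)ᶜ := by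
    by_contra! hne
    have h8 : P.real S ≤ 1 - P.real (E ∪ D)ᶜ := by
      rw [← probReal_compl_eq_one_sub hBm]
      exact measureReal_mono fun y hy => hne y hy
    have h9 : P.real (E ∪ D)ᶜ ≤ b * Real.exp (-a * r) := by linarith
    have h10 : Real.exp (N * (H + ε)) * Real.exp (-a * r) = Real.exp (-(N * ε)) := by
      rw [← Real.exp_add, hr]
      congr 1
      field_simp
      ring
    have h11 := hBQ.trans (hBP.trans (mul_le_mul_of_nonneg_left h9 (Real.exp_pos _).le))
    rw [mul_left_comm, h10] at h11
    linarith
  obtain ⟨y, hyS, hyB⟩ := hex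
  obtain ⟨x, hxA, hcost⟩ := exists_cost_le_of_mem_enlargement hp hr0 hyS
  refine ⟨n, x, y, ?_, ?_, ?_⟩
  · by_contra hx
    exact hxA (subset_toMeasurable _ _ hx)
  · by_contra hy
    exact hyB (Or.inl (subset_toMeasurable _ _ hy))
  · rw [div_le_iff₀ hNpos]
    refine hcost.trans_eq ?_
    rw [hr]
    ring

/-- Lower semicontinuity of the transportation cost along couplings of weakly convergent
marginals. -/
lemma transportCost_le_of_tendsto {p : ℝ} (hp : 0 ≤ p) {μ ν : ProbabilityMeasure (Fin d → ℝ)}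
    {π : ℕ → ProbabilityMeasure ((Fin d → ℝ) × (Fin d → ℝ))}
    (hfst : Tendsto (fun m => (π m).map measurable_fst.aemeasurable) atTop (𝓝 ν))
    (hsnd : Tendsto (fun m => (π m).map measurable_snd.aemeasurable) atTop (𝓝 μ))
    {K : ℕ → ℝ≥0∞} {L : ℝ≥0∞} (hK : Tendsto K atTop (𝓝 L))
    (hcost : ∀ m, ∫⁻ z, ENNReal.ofReal (∑ j, twoLevelCost p (z.1 j - z.2 j))
      ∂(π m : Measure ((Fin d → ℝ) × (Fin d → ℝ))) ≤ K m) :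
    transportCost p (ν : Measure (Fin d → ℝ)) μ ≤ L := by
  -- Convergent marginals are tight, hence so are the couplings; Prokhorov's theorem gives a limit
  -- coupling.
  have tight : ∀ {ρ : ℕ → ProbabilityMeasure (Fin d → ℝ)} {ρ₀ : ProbabilityMeasure (Fin d → ℝ)},
      Tendsto ρ atTop (𝓝 ρ₀) →
      IsTightMeasureSet {((τ : ProbabilityMeasure (Fin d → ℝ)) : Measure (Fin d → ℝ)) |
        τ ∈ Set.range ρ} := fun {ρ ρ₀} hρ =>
    isTightMeasureSet_of_isCompact_closure
      (hρ.isCompact_insert_range.closure_of_subset (Set.subset_insert _ _))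
  have hπ : IsTightMeasureSet {((τ : ProbabilityMeasure ((Fin d → ℝ) × (Fin d → ℝ))) :
      Measure ((Fin d → ℝ) × (Fin d → ℝ))) | τ ∈ Set.range π} := by
    refine IsTightMeasureSet.prodMk ((tight hfst).subset ?_) ((tight hsnd).subset ?_)
    · rintro _ ⟨_, ⟨_, ⟨m, rfl⟩, rfl⟩, rfl⟩
      exact ⟨_, ⟨m, rfl⟩, rfl⟩
    · rintro _ ⟨_, ⟨_, ⟨m, rfl⟩, rfl⟩, rfl⟩
      exact ⟨_, ⟨m, rfl⟩, rfl⟩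
  obtain ⟨π₀, -, φ, hφ, hlim⟩ := (isCompact_closure_of_isTightMeasureSet hπ).isSeqCompact
    fun m => subset_closure (Set.mem_range_self m)
  have h1 : π₀.map measurable_fst.aemeasurable = ν :=
    tendsto_nhds_unique
      (ProbabilityMeasure.tendsto_map_of_tendsto_of_continuous _ _ hlim continuous_fst)
      (hfst.comp hφ.tendsto_atTop)
  have h2 : π₀.map measurable_snd.aemeasurable = μ :=
    tendsto_nhds_unique
      (ProbabilityMeasure.tendsto_map_of_tendsto_of_continuous _ _ hlim continuous_snd)
      (hsnd.comp hφ.tendsto_atTop)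
  refine (iInf₂_le (π₀ : Measure ((Fin d → ℝ) × (Fin d → ℝ)))
    ⟨congrArg Subtype.val h1, congrArg Subtype.val h2⟩).trans ?_
  refine (lintegral_le_liminf_lintegral_of_forall_isOpen_measure_le_liminf_measure
    (μs := fun m => (π (φ m) : Measure ((Fin d → ℝ) × (Fin d → ℝ))))
    (continuous_sum_twoLevelCost hp)
    (fun z => Finset.sum_nonneg fun j _ => twoLevelCost_nonneg p _)
    fun G hG => ProbabilityMeasure.le_liminf_measure_open_of_tendsto hlim hG).trans ?_
  calc _ ≤ liminf (fun m => K (φ m)) atTop := liminf_le_liminf (Eventually.of_forall fun m =>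
        hcost (φ m))
    _ = L := (hK.comp hφ.tendsto_atTop).liminf_eq

theorem TwoLevelConcentration.transportInequality {p a b : ℝ} (hp : p ∈ Set.Icc (1 : ℝ) 2)
    (ha : 0 < a) {μ : Measure (Fin d → ℝ)} [IsProbabilityMeasure μ]
    (h : TwoLevelConcentration μ p a b) : TransportInequality μ p (4 / a) := by
  intro ν hν
  by_cases hkl : InformationTheory.klDiv ν μ = ∞
  · rw [hkl, ENNReal.mul_top (by simpa using by positivity)]
    exact le_top
  obtain ⟨hac, hint⟩ := InformationTheory.klDiv_ne_top_iff.1 hkl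
  let μ' : ProbabilityMeasure (Fin d → ℝ) := ⟨μ, inferInstance⟩
  let ν' : ProbabilityMeasure (Fin d → ℝ) := ⟨ν, hν⟩
  -- Countable neighbourhood bases allow both empirical measures to converge while `ε = 1 / (m + 1)`
  -- tends to 0.
  obtain ⟨V, hV⟩ := (𝓝 μ').exists_antitone_basis
  obtain ⟨W, hW⟩ := (𝓝 ν').exists_antitone_basis
  have key := fun m : ℕ => TwoLevelConcentration.exists_empirical_near (μ := μ') (ν := ν') hp ha h
    hac hint (hV.mem m) (hW.mem m) (Nat.one_div_pos_of_nat (α := ℝ) (n := m))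
  choose n x y hx hy hxy using key
  have hK : Tendsto (fun m : ℕ => ENNReal.ofReal
      (4 * ((∫ z, llr ν μ z ∂ν + 2 * (1 / ((m : ℝ) + 1))) / a))) atTop
      (𝓝 (ENNReal.ofReal (4 * ((∫ z, llr ν μ z ∂ν + 2 * 0) / a)))) :=
    ENNReal.tendsto_ofReal (((tendsto_one_div_add_atTop_nhds_zero_nat.const_mul 2).const_add
      _).div_const a |>.const_mul 4)
  have hc : ENNReal.ofReal (4 / a) * InformationTheory.klDiv ν μ =
      ENNReal.ofReal (4 * ((∫ z, llr ν μ z ∂ν + 2 * 0) / a)) := by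
    rw [InformationTheory.klDiv_of_ac_of_integrable hac hint,
      ← ENNReal.ofReal_mul (by positivity)]
    congr 1
    simp
    ring
  rw [hc]
  refine transportCost_le_of_tendsto (μ := μ') (ν := ν')
    (π := fun m => empirical fun i => (y m i, x m i)) (by linarith [hp.1]) ?_ ?_ hK fun m => ?_
  · simp_rw [empirical_map _ measurable_fst]
    exact hW.tendsto hy
  · simp_rw [empirical_map _ measurable_snd]
    exact hV.tendsto hx
  · rw [lintegral_empirical_ofReal _ (continuous_sum_twoLevelCost (by linarith [hp.1])).measurable
      fun z => Finset.sum_nonneg fun j _ => twoLevelCost_nonneg p _]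
    exact ENNReal.ofReal_le_ofReal (hxy m)

end Concentration

/-! ### Assembly of the equivalence. -/

lemma TransportInequality.mono {d : ℕ} {μ : Measure (Fin d → ℝ)} {p C C' : ℝ} (hC : C ≤ C')
    (h : TransportInequality μ p C) : TransportInequality μ p C' := fun ν hν =>
  (h ν hν).trans (by gcongr)

theorem mainTheorem5 (d : ℕ) (μ : Measure (Fin d → ℝ)) [IsProbabilityMeasure μ]
    (p : ℝ) (hp : p ∈ Set.Icc (1 : ℝ) 2) :
    ((∃ a b : ℝ, 0 < a ∧ 0 ≤ b ∧ TwoLevelConcentration μ p a b) ↔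
      ∃ C : ℝ, 0 < C ∧ TransportInequality μ p C) ∧
    (∀ a b : ℝ, 0 < a → 0 ≤ b → TwoLevelConcentration μ p a b →
      TransportInequality μ p (288 / a)) ∧
    (∀ C : ℝ, 0 < C → TransportInequality μ p C →
      TwoLevelConcentration μ p (1 / (2 * C)) 2) := by
  have h1 : ∀ a b : ℝ, 0 < a → 0 ≤ b → TwoLevelConcentration μ p a b →
      TransportInequality μ p (288 / a) := fun a b ha _ h =>
    (h.transportInequality hp ha).mono (by gcongr; norm_num)
  have h2 : ∀ C : ℝ, 0 < C → TransportInequality μ p C →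
      TwoLevelConcentration μ p (1 / (2 * C)) 2 := fun C hC h => h.twoLevelConcentration hp hC
  refine ⟨⟨?_, ?_⟩, h1, h2⟩
  · rintro ⟨a, b, ha, hb, h⟩
    exact ⟨288 / a, by positivity, h1 a b ha hb h⟩
  · rintro ⟨C, hC, h⟩
    exact ⟨1 / (2 * C), 2, by positivity, by norm_num, h2 C hC h⟩
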